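/- Conventions. A semilattice is a commutative semigroup of idempotents, ordered by $x\le y \iff xy=x$; a topologized semilattice is a semilattice with a topology, and it is semitopological if its operation is separately continuous. A topologized semilattice $S$ is complete if every non-empty chain $C\subset S$ has an infimum and a supremum in $S$, both of which belong to the closure $\overline{C}$ of $C$ in $S$. A semitopological semilattice $Y$ is $\omega$-Lawson if it is Hausdorff and its Lawson number is at most countable, where the Lawson number is the smallest cardinal $\kappa$ such that for any distinct $x,y\in Y$ there is a family $\mathcal U$ of closed neighborhoods of $x$ with $|\mathcal U|\le\kappa$ such that $\bigcap\mathcal U$ is a subsemilattice of $Y$ not containing $y$. A space $Y$ is functionally Hausdorff if for any distinct $x,y\in Y$ there is a continuous $f:Y\to\mathbb R$ with $f(x)\ne f(y)$, and sequential if every non-closed set $A\subset Y$ contains a sequence converging to a point of $\overline{A}\setminus A$. A multi-valued map $\Phi:X\multimap Y$ assigns to each $x\in X$ a (possibly empty) subset $\Phi(x)\subset Y$; it is upper semicontinuous if $\{x\in X:\Phi(x)\cap F\ne\emptyset\}$ is closed in $X$ for every closed $F\subset Y$; it is a multimorphism if $\Phi(x)\Phi(y)\subset\Phi(xy)$ for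 all $x,y\in X$, and a $T_1$ multimorphism if moreover every point of $Y\setminus\Phi(x)$ has a neighborhood disjoint from $\Phi(x)$, for each $x\in X$. For $A\subset Y$ put ${\uparrow}A=\{z\in Y: a\le z\text{ for some }a\in A\}$. Corollary 2.7. Let $X$ be a complete topologized semilattice, and let $Y$ be a semitopological semilattice which is $\omega$-Lawson, or functionally Hausdorff, or sequential and Hausdorff. Let $\Phi:X\multimap Y$ be an upper semicontinuous $T_1$ multimorphism such that for any $x,y\in X$ with $x\le y$ one has $\Phi(x)\cap{\uparrow}\Phi(y)\subset\Phi(y)$, and such that for each $x\in X$ the subsemilattice $\Phi(x)$ of $Y$ (with the subspace topology) is complete. Then the set $\Phi(X)=\bigcup_{x\in X}\Phi(x)$ is closed in $Y$. -/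

import Mathlib

open Set Topology

namespace TopSemilattice

/-! A semilattice is Mathlib's `SemilatticeInf`: the product `xy` is `x ⊓ y`, and `x ≤ y` means
`x ⊓ y = x`.  A topologized semilattice carries in addition an arbitrary topology. -/

/-- Completeness: every nonempty chain `C` has an infimum and a supremum, and both lie in the
closure of `C`.  Only the order and the topology enter, so this also applies to a subsemilattice
`S` with the induced order and the subspace topology (infimum, supremum and closure being
taken in `S`). -/
def IsComplete (X : Type*) [PartialOrder X] [TopologicalSpace X] : Prop :=
  ∀ C : Set X, C.Nonempty → IsChain (· ≤ ·) C →
    (∃ a, IsGLB C a ∧ a ∈ closure C) ∧ (∃ b, IsLUB C b ∧ b ∈ closure C)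

/-- Semitopological semilattice: the operation is separately continuous. -/
def IsSemitopological (Y : Type*) [SemilatticeInf Y] [TopologicalSpace Y] : Prop :=
  (∀ a : Y, Continuous fun y : Y => a ⊓ y) ∧ (∀ a : Y, Continuous fun y : Y => y ⊓ a)

/-- `κ` is admissible in the definition of the Lawson number: for distinct `x`, `y` there is a
family of at most `κ` closed neighbourhoods of `x` whose intersection is a subsemilattice
not containing `y`. -/
def LawsonBound (Y : Type*) [SemilatticeInf Y] [TopologicalSpace Y] (κ : Cardinal) : Prop :=
  ∀ x y : Y, x ≠ y → ∃ 𝒰 : Set (Set Y),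
    (∀ U ∈ 𝒰, U ∈ 𝓝 x ∧ IsClosed U) ∧ Cardinal.mk 𝒰 ≤ κ ∧
      InfClosed (⋂₀ 𝒰) ∧ y ∉ ⋂₀ 𝒰

/-- The Lawson number, the smallest admissible cardinal. (In a Hausdorff space admissible cardinals
exist, since the closed neighbourhoods of `x` intersect in `{x}`.) -/
noncomputable def lawsonNumber (Y : Type*) [SemilatticeInf Y] [TopologicalSpace Y] : Cardinal :=
  sInf {κ | LawsonBound Y κ}

/-- `ω`-Lawson: Hausdorff with at most countable Lawson number. -/
def IsOmegaLawson (Y : Type*) [SemilatticeInf Y] [TopologicalSpace Y] : Prop :=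
  T2Space Y ∧ lawsonNumber Y ≤ Cardinal.aleph0

/-- Functionally Hausdorff: continuous real-valued functions separate points. -/
def IsFunctionallyHausdorff (Y : Type*) [TopologicalSpace Y] : Prop :=
  ∀ x y : Y, x ≠ y → ∃ f : Y → ℝ, Continuous f ∧ f x ≠ f y

/-- The image of a set under a multi-valued map. -/
def image {X Y : Type*} (Φ : X → Set Y) (A : Set X) : Set Y := ⋃ x ∈ A, Φ x

/-- The preimage of a set under a multi-valued map. -/
def preimage {X Y : Type*} (Φ : X → Set Y) (B : Set Y) : Set X := {x | (Φ x ∩ B).Nonempty}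

/-- Multimorphism: `Φ(x)Φ(y) ⊆ Φ(xy)`. -/
def IsMultimorphism {X Y : Type*} [SemilatticeInf X] [SemilatticeInf Y] (Φ : X → Set Y) : Prop :=
  ∀ x y : X, ∀ a ∈ Φ x, ∀ b ∈ Φ y, a ⊓ b ∈ Φ (x ⊓ y)

/-- Upper semicontinuity: preimages of closed sets are closed. -/
def IsUpperSemicontinuous {X Y : Type*} [TopologicalSpace X] [TopologicalSpace Y]
    (Φ : X → Set Y) : Prop :=
  ∀ F : Set Y, IsClosed F → IsClosed (preimage Φ F)

/-- `F` is `T₁`-closed: each point outside `F` has a neighbourhood disjoint from `F`. -/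
def IsT1Closed {Y : Type*} [TopologicalSpace Y] (F : Set Y) : Prop :=
  ∀ y ∉ F, ∃ U ∈ 𝓝 y, Disjoint U F

/-- `T₁`-multimorphism: a multimorphism all of whose values are `T₁`-closed. -/
def IsT1Multimorphism {X Y : Type*} [SemilatticeInf X] [SemilatticeInf Y] [TopologicalSpace Y]
    (Φ : X → Set Y) : Prop :=
  IsMultimorphism Φ ∧ ∀ x : X, IsT1Closed (Φ x)

end TopSemilattice

/-! Write `S` for the image of `Φ`. In the Hausdorff space `Y` the proof has two halves. `S` is
chain complete (`chainComplete_image`): a chain in `S` is moved to `X` by sending `c` to the least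
`x` with `c ∈ Φ x`. Its infimum or supremum there is a limit of the transferred chain, so upper
semicontinuity makes the value at that point meet the closure of the original chain, and
completeness of the value supplies the extremum. A chain complete subsemilattice is closed. Near a
point `y` of its closure, points of `S` are selected recursively so that their finite meets stay in
prescribed sets around `y` (`exists_selection`). The closed subsemilattices generated by tails
decrease, and chain completeness gives them a common point in `S`. Under the first two separation
hypotheses, induction on cardinality forces that point to be `y`. In the sequential case, a limit
inferior made maximal by Zorn's lemma equals `y`. -/

namespace TopSemilattice

/-- Every nonempty chain of `S` has an infimum and a supremum in the ambient poset, and both lie in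
`S` and in the closure of the chain. -/
def ChainComplete {X : Type*} [PartialOrder X] [TopologicalSpace X] (S : Set X) : Prop :=
  ∀ C ⊆ S, C.Nonempty → IsChain (· ≤ ·) C →
    (∃ a ∈ S, IsGLB C a ∧ a ∈ closure C) ∧ (∃ b ∈ S, IsLUB C b ∧ b ∈ closure C)

theorem IsComplete.chainComplete_univ {X : Type*} [PartialOrder X] [TopologicalSpace X]
    (h : IsComplete X) : ChainComplete (univ : Set X) := by
  intro C _ hC hchain
  simpa using h C hC hchain

theorem infClosed_inter {X : Type*} [SemilatticeInf X] {A B : Set X} (hA : InfClosed A)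
    (hB : InfClosed B) : InfClosed (A ∩ B) :=
  fun _ ha _ hb => ⟨hA ha.1 hb.1, hB ha.2 hb.2⟩

/-! ### Chain completeness as a substitute for compactness -/

section ChainComplete

variable {X : Type*} [SemilatticeInf X] [TopologicalSpace X] {S : Set X}

/-- Infima of chains stay in the closed set, so Zorn gives a minimal element; closure under meets
makes it least. -/
theorem ChainComplete.exists_isLeast (hS : ChainComplete S) {A : Set X} (hA : IsClosed A)
    (hinf : InfClosed (S ∩ A)) (hne : (S ∩ A).Nonempty) : ∃ m, IsLeast (S ∩ A) m := by
  obtain ⟨x, hx⟩ := hne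
  obtain ⟨m, -, hm⟩ := zorn_le_nonempty₀ (α := Xᵒᵈ) (OrderDual.ofDual ⁻¹' (S ∩ A)) (by
    intro c hc hchain y hy
    obtain ⟨a, haS, hglb, hcl⟩ := (hS (OrderDual.toDual ⁻¹' c) (fun z hz => (hc hz).1) ⟨y, hy⟩
      (fun a ha b hb hab => (hchain ha hb hab).symm)).1
    exact ⟨OrderDual.toDual a, ⟨haS, closure_minimal (fun z hz => (hc hz).2) hA hcl⟩,
      fun z hz => hglb.1 hz⟩) x hx
  refine ⟨OrderDual.ofDual m, hm.prop, fun z hz => ?_⟩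
  have h := hm.le_of_ge (y := OrderDual.toDual (OrderDual.ofDual m ⊓ z)) (hinf hm.prop hz)
    inf_le_left
  exact le_trans (OrderDual.toDual_le_toDual.1 h) inf_le_right

/-- Every tail of an increasing family has the same supremum, which therefore lies in the closure of
each tail. -/
theorem ChainComplete.exists_isLUB_range (hS : ChainComplete S) {I : Type*} [LinearOrder I]
    [Nonempty I] {m : I → X} (hm : Monotone m) (hmS : ∀ i, m i ∈ S) :
    ∃ b ∈ S, IsLUB (range m) b ∧ ∀ i, b ∈ closure (m '' Ici i) := by
  obtain ⟨b, hbS, hb, -⟩ := (hS (range m) (range_subset_iff.2 hmS) (range_nonempty m)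
    hm.isChain_range).2
  refine ⟨b, hbS, hb, fun i => ?_⟩
  obtain ⟨b', -, hb', hcl⟩ := (hS (m '' Ici i) (by rintro _ ⟨j, -, rfl⟩; exact hmS j)
    ⟨m i, i, le_rfl, rfl⟩ (hm.isChain_range.mono (image_subset_range _ _))).2
  suffices b = b' from this ▸ hcl
  refine hb.unique ⟨?_, fun u hu => hb'.2 ?_⟩
  · rintro _ ⟨j, rfl⟩
    exact (hm (le_max_left j i)).trans (hb'.1 ⟨_, le_max_right j i, rfl⟩)
  · rintro _ ⟨j, -, rfl⟩
    exact hu ⟨j, rfl⟩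

/-- As the sets shrink their least elements increase; the supremum of these works. -/
theorem ChainComplete.exists_mem_forall_of_antitone (hS : ChainComplete S) {I : Type*}
    [LinearOrder I] [Nonempty I] {A : I → Set X} (hanti : Antitone A) (hcl : ∀ i, IsClosed (A i))
    (hinf : ∀ i, InfClosed (S ∩ A i)) (hne : ∀ i, (S ∩ A i).Nonempty) :
    ∃ s ∈ S, ∀ i, s ∈ A i := by
  choose m hm using fun i => hS.exists_isLeast (hcl i) (hinf i) (hne i)
  have hmono : Monotone m := fun i j hij => (hm i).2 ⟨(hm j).1.1, hanti hij (hm j).1.2⟩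
  obtain ⟨b, hbS, -, hb⟩ := hS.exists_isLUB_range hmono fun i => (hm i).1.1
  refine ⟨b, hbS, fun i => closure_minimal ?_ (hcl i) (hb i)⟩
  rintro _ ⟨j, hj, rfl⟩
  exact hanti hj (hm j).1.2

end ChainComplete

/-! ### Closures in Hausdorff semitopological semilattices -/

section Semitopological

variable {Y : Type*} [SemilatticeInf Y] [TopologicalSpace Y]

theorem IsSemitopological.isClosed_Iic [T2Space Y] (hY : IsSemitopological Y) (c : Y) :
    IsClosed (Iic c) := by
  have : Iic c = {z | z ⊓ c = z} := by ext z; simp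
  rw [this]
  exact isClosed_eq (hY.2 c) continuous_id

theorem IsSemitopological.isClosed_Ici [T2Space Y] (hY : IsSemitopological Y) (c : Y) :
    IsClosed (Ici c) := by
  have : Ici c = {z | c ⊓ z = c} := by ext z; simp
  rw [this]
  exact isClosed_eq (hY.1 c) continuous_const

theorem IsSemitopological.infClosed_closure (hY : IsSemitopological Y) {A : Set Y}
    (hA : InfClosed A) : InfClosed (closure A) := by
  have h1 : ∀ a ∈ A, ∀ b ∈ closure A, a ⊓ b ∈ closure A := fun a ha b hb =>
    map_mem_closure (hY.1 a) hb fun c hc => hA ha hc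
  intro a ha b hb
  have h := map_mem_closure (t := closure A) (hY.2 b) ha fun c hc => h1 c hc b hb
  rwa [closure_closure] at h

/-- The closure of a chain is a chain. -/
theorem IsSemitopological.isChain_closure [T2Space Y] (hY : IsSemitopological Y) {C : Set Y}
    (hC : IsChain (· ≤ ·) C) : IsChain (· ≤ ·) (closure C) := by
  have hcl : ∀ c, IsClosed (Iic c ∪ Ici c) := fun c => (hY.isClosed_Iic c).union (hY.isClosed_Ici c)
  have h1 : ∀ a ∈ C, ∀ b ∈ closure C, b ≤ a ∨ a ≤ b := fun a ha b hb =>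
    closure_minimal (fun c hc => hC.total hc ha) (hcl a) hb
  intro a ha b hb _
  exact closure_minimal (t := Iic b ∪ Ici b) (fun c hc => (h1 c hc b hb).symm) (hcl b) ha

theorem ChainComplete.exists_isGLB [T2Space Y] (hY : IsSemitopological Y) {S : Set Y}
    (hS : ChainComplete S) (hSinf : InfClosed S) {A : Set Y} (hA : A ⊆ S) (hne : A.Nonempty) :
    ∃ z ∈ S, IsGLB A z ∧ z ∈ closure (infClosure A) := by
  obtain ⟨x, hx⟩ := hne
  obtain ⟨m, hm, hmin⟩ := hS.exists_isLeast (A := closure (infClosure A)) isClosed_closure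
    (infClosed_inter hSinf (hY.infClosed_closure infClosed_infClosure))
    ⟨x, hA hx, subset_closure (subset_infClosure hx)⟩
  refine ⟨m, hm.1, ⟨fun a ha => hmin ⟨hA ha, subset_closure (subset_infClosure ha)⟩,
    fun w hw => ?_⟩, hm.2⟩
  refine closure_minimal (t := Ici w) (infClosure_min hw ?_) (hY.isClosed_Ici w) hm.2
  exact fun a ha b hb => le_inf ha hb

end Semitopological

/-! ### Chain completeness of the image -/

section Multimorphism

variable {X Y : Type*} [SemilatticeInf X] [SemilatticeInf Y]

theorem IsMultimorphism.infClosed_image {Φ : X → Set Y} (hΦ : IsMultimorphism Φ) :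
    InfClosed (image Φ univ) := by
  intro a ha b hb
  simp only [image, mem_univ, iUnion_true, mem_iUnion] at ha hb ⊢
  obtain ⟨x, hx⟩ := ha
  obtain ⟨z, hz⟩ := hb
  exact ⟨_, hΦ _ _ _ hx _ hz⟩

variable [TopologicalSpace X] [TopologicalSpace Y]

/-- In a complete subspace, the nonempty relatively closed chains have extreme elements. -/
theorem IsComplete.exists_isLeast_isGreatest {F : Set Y} (hF : IsComplete F) {K : Set Y}
    (hK : IsClosed K) (hchain : IsChain (· ≤ ·) (F ∩ K)) (hne : (F ∩ K).Nonempty) :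
    (∃ a, IsLeast (F ∩ K) a) ∧ ∃ b, IsGreatest (F ∩ K) b := by
  obtain ⟨x, hxF, hxK⟩ := hne
  have hcl : closure (Subtype.val ⁻¹' K : Set F) ⊆ Subtype.val ⁻¹' K :=
    (hK.preimage continuous_subtype_val).closure_subset
  obtain ⟨⟨a, ha, hacl⟩, ⟨b, hb, hbcl⟩⟩ := hF (Subtype.val ⁻¹' K : Set F) ⟨⟨x, hxF⟩, hxK⟩
    (fun p hp q hq hpq => hchain ⟨p.2, hp⟩ ⟨q.2, hq⟩ (fun h => hpq (Subtype.ext h)))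
  exact ⟨⟨a, ⟨a.2, hcl hacl⟩, fun z hz => ha.1 (show (⟨z, hz.1⟩ : F) ∈ Subtype.val ⁻¹' K from hz.2)⟩,
    ⟨b, ⟨b.2, hcl hbcl⟩, fun z hz => hb.1 (show (⟨z, hz.1⟩ : F) ∈ Subtype.val ⁻¹' K from hz.2)⟩⟩

/-- The image of a complete topologized semilattice under an upper semicontinuous multimorphism
with complete values is chain complete in the ambient semilattice. -/
theorem chainComplete_image [T2Space Y] (hX : IsComplete X) (hY : IsSemitopological Y)
    {Φ : X → Set Y} (husc : IsUpperSemicontinuous Φ) (hΦ : IsMultimorphism Φ)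
    (hfib : ∀ x, IsComplete (Φ x)) : ChainComplete (image Φ univ) := by
  have hmem : ∀ {c}, c ∈ image Φ univ ↔ ∃ x, c ∈ Φ x := by simp [image]
  have hleast : ∀ c, c ∈ image Φ univ → ∃ m, IsLeast {x | c ∈ Φ x} m := by
    intro c hc
    have hcl : IsClosed {x | c ∈ Φ x} := by
      simpa [preimage] using husc {c} isClosed_singleton
    have hinf : InfClosed {x | c ∈ Φ x} := fun a ha b hb => by
      simpa using hΦ a b c ha c hb
    obtain ⟨x, hx⟩ := hmem.1 hc
    simpa using hX.chainComplete_univ.exists_isLeast hcl (by simpa using hinf) ⟨x, by simpa using hx⟩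
  rcases isEmpty_or_nonempty X with hX0 | hX0
  · rintro C hC ⟨c, hc⟩ -
    exact (hX0.false (hmem.1 (hC hc)).choose).elim
  choose! m hm using hleast
  have hmono : ∀ c ∈ image Φ univ, ∀ d ∈ image Φ univ, c ≤ d → m c ≤ m d := fun c hc d hd hcd =>
    ((hm c hc).2 (by
      have := hΦ _ _ _ (hm c hc).1 _ (hm d hd).1
      rwa [inf_eq_left.2 hcd] at this : c ∈ Φ (m c ⊓ m d))).trans inf_le_right
  have himage : ∀ C ⊆ image Φ univ, IsChain (· ≤ ·) C → IsChain (· ≤ ·) (m '' C) := by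
    rintro C hC hchain _ ⟨c, hc, rfl⟩ _ ⟨d, hd, rfl⟩ -
    exact (hchain.total hc hd).imp (hmono _ (hC hc) _ (hC hd)) (hmono _ (hC hd) _ (hC hc))
  have hmeet : ∀ C ⊆ image Φ univ, ∀ x ∈ closure (m '' C), (Φ x ∩ closure C).Nonempty := by
    intro C hC x hx
    refine closure_minimal (t := preimage Φ (closure C)) ?_ (husc _ isClosed_closure) hx
    rintro _ ⟨c, hc, rfl⟩
    exact ⟨c, (hm c (hC hc)).1, subset_closure hc⟩
  intro C hC hne hchain
  have hKchain : ∀ x, IsChain (· ≤ ·) (Φ x ∩ closure C) := fun x =>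
    (hY.isChain_closure hchain).mono inter_subset_right
  constructor
  · obtain ⟨x, hx, hxcl⟩ := (hX _ (hne.image m) (himage C hC hchain)).1
    obtain ⟨q, ⟨hqΦ, hqC⟩, hq⟩ := ((hfib x).exists_isLeast_isGreatest isClosed_closure (hKchain x)
      (hmeet C hC x hxcl)).1
    refine ⟨q, hmem.2 ⟨x, hqΦ⟩, ⟨fun c hc => ?_, fun w hw => ?_⟩, hqC⟩
    -- Cutting the chain at `c` keeps the infimum `x`, so `Φ x` also meets the closure of the part
    -- below `c`; `q` lies below such a point.
    · have hsub : C ∩ Iic c ⊆ C := inter_subset_left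
      obtain ⟨x', hx', hx'cl⟩ := (hX (m '' (C ∩ Iic c)) ⟨m c, c, ⟨hc, le_rfl⟩, rfl⟩
        (himage _ (hsub.trans hC) (hchain.mono hsub))).1
      have hxx' : x' = x := by
        refine hx'.unique ⟨lowerBounds_mono_set (image_mono hsub) hx.1, fun w hw => hx.2 ?_⟩
        rintro _ ⟨d, hd, rfl⟩
        rcases hchain.total hc hd with h | h
        · exact (hw ⟨c, ⟨hc, le_rfl⟩, rfl⟩).trans (hmono _ (hC hc) _ (hC hd) h)
        · exact hw ⟨d, ⟨hd, h⟩, rfl⟩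
      obtain ⟨p, hpΦ, hp⟩ := hmeet _ (hsub.trans hC) x (hxx' ▸ hx'cl)
      exact (hq ⟨hpΦ, closure_mono hsub hp⟩).trans
        (closure_minimal inter_subset_right (hY.isClosed_Iic c) hp)
    · exact closure_minimal (t := Ici w) hw (hY.isClosed_Ici w) hqC
  · obtain ⟨x, hx, hxcl⟩ := (hX _ (hne.image m) (himage C hC hchain)).2
    obtain ⟨q, ⟨hqΦ, hqC⟩, hq⟩ := ((hfib x).exists_isLeast_isGreatest isClosed_closure (hKchain x)
      (hmeet C hC x hxcl)).2
    refine ⟨q, hmem.2 ⟨x, hqΦ⟩, ⟨fun c hc => ?_, fun w hw => ?_⟩, hqC⟩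
    · have hsub : C ∩ Ici c ⊆ C := inter_subset_left
      obtain ⟨x', hx', hx'cl⟩ := (hX (m '' (C ∩ Ici c)) ⟨m c, c, ⟨hc, le_rfl⟩, rfl⟩
        (himage _ (hsub.trans hC) (hchain.mono hsub))).2
      have hxx' : x' = x := by
        refine hx'.unique ⟨upperBounds_mono_set (image_mono hsub) hx.1, fun w hw => hx.2 ?_⟩
        rintro _ ⟨d, hd, rfl⟩
        rcases hchain.total hd hc with h | h
        · exact (hmono _ (hC hd) _ (hC hc) h).trans (hw ⟨c, ⟨hc, le_rfl⟩, rfl⟩)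
        · exact hw ⟨d, ⟨hd, h⟩, rfl⟩
      obtain ⟨p, hpΦ, hp⟩ := hmeet _ (hsub.trans hC) x (hxx' ▸ hx'cl)
      exact (closure_minimal inter_subset_right (hY.isClosed_Ici c) hp : c ≤ p).trans
        (hq ⟨hpΦ, closure_mono hsub hp⟩)
    · exact closure_minimal (t := Iic w) hw (hY.isClosed_Iic w) hqC

end Multimorphism

/-! ### Recursive selection with controlled meets -/

section Selection

variable {Y : Type*} [SemilatticeInf Y] {I : Type*}

/-- The meet of `z` with the elements `x j`, `j ∈ t`. -/
def meetWith (x : I → Y) (t : Finset I) (z : Y) : Y := t.fold (· ⊓ ·) z x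

theorem le_meetWith {x : I → Y} {t : Finset I} {z w : Y} :
    w ≤ meetWith x t z ↔ w ≤ z ∧ ∀ j ∈ t, w ≤ x j := by
  classical
  induction t using Finset.induction_on with
  | empty => simp [meetWith]
  | insert a t ha ih =>
    have : meetWith x (insert a t) z = x a ⊓ meetWith x t z := Finset.fold_insert ha
    rw [this, le_inf_iff, ih, Finset.forall_mem_insert]
    tauto

theorem meetWith_insert_eq [DecidableEq I] (x : I → Y) (t : Finset I) (a : I) (z : Y) :
    meetWith x (insert a t) z = meetWith x t (x a ⊓ z) :=
  eq_of_forall_le_iff fun w => by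
    simp only [le_meetWith, Finset.forall_mem_insert, le_inf_iff]; tauto

theorem meetWith_congr {x x' : I → Y} {t : Finset I} (h : ∀ j ∈ t, x j = x' j) (z : Y) :
    meetWith x t z = meetWith x' t z :=
  Finset.fold_congr h

theorem IsSemitopological.continuous_meetWith [TopologicalSpace Y] (hY : IsSemitopological Y)
    (x : I → Y) (t : Finset I) : Continuous (meetWith x t) := by
  classical
  induction t using Finset.induction_on with
  | empty => exact continuous_id
  | insert a t ha ih =>
    have : meetWith x (insert a t) = fun z => x a ⊓ meetWith x t z :=
      funext fun z => Finset.fold_insert ha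
    rw [this]
    exact (hY.1 (x a)).comp ih

/-- Transfinite selection of points whose finite meets stay in prescribed sets. -/
theorem exists_selection [LinearOrder I] [WellFoundedLT I] {V : I → Set Y} {y : Y}
    (hyV : ∀ i, y ∈ V i) {S : I → Set Y}
    (hsel : ∀ (a : I) (x : I → Y), ∃ s ∈ S a, ∀ i < a, ∀ t : Finset I, (∀ j ∈ t, j < a) →
      meetWith x t y ∈ V i → meetWith x t s ∈ V i ∧ meetWith x t (s ⊓ y) ∈ V i) :
    ∃ x : I → Y, (∀ a, x a ∈ S a) ∧ ∀ i, infClosure (x '' Ioi i) ⊆ V i := by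
  classical
  choose sel hselS hselV using hsel
  -- The default `y` at indices `≥ a` is never consulted: only meets over indices below `a` matter.
  let ext (a : I) (g : ∀ j, j < a → Y) : I → Y := fun j => if h : j < a then g j h else y
  let x : I → Y := wellFounded_lt.fix fun a g => sel a (ext a g)
  have hx : ∀ a, x a = sel a (ext a fun j _ => x j) := fun a =>
    wellFounded_lt.fix_eq (fun a g => sel a (ext a g)) a
  have hV : ∀ a, ∀ i < a, ∀ t : Finset I, (∀ j ∈ t, j < a) → meetWith x t y ∈ V i →
      meetWith x t (x a) ∈ V i ∧ meetWith x t (x a ⊓ y) ∈ V i := by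
    intro a i hi t ht hty
    have hcongr : ∀ z, meetWith (ext a fun j _ => x j) t z = meetWith x t z :=
      meetWith_congr fun j hj => by simp [ext, ht j hj]
    have h := hselV a (ext a fun j _ => x j) i hi t ht (by rwa [hcongr])
    rwa [hcongr, hcongr, ← hx] at h
  -- The invariant keeps `y` as a factor; the largest index is adjoined last, since it was chosen
  -- knowing all the others.
  have hy : ∀ i, ∀ t : Finset I, (∀ j ∈ t, i < j) → meetWith x t y ∈ V i := by
    intro i t
    induction t using Finset.induction_on_max with
    | empty => exact fun _ => hyV i
    | insert a t hta ih =>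
      intro hi
      rw [Finset.forall_mem_insert] at hi
      rw [meetWith_insert_eq]
      exact (hV a i hi.1 t hta (ih hi.2)).2
  refine ⟨x, fun a => hx a ▸ hselS _ _, fun i => ?_⟩
  rintro _ ⟨t, ht, hts, rfl⟩
  obtain ⟨u, hu, rfl⟩ := Finset.subset_set_image_iff.1 hts
  have hune : u.Nonempty := Finset.image_nonempty.1 ht
  have hmax := u.max'_mem hune
  have heq : (u.image x).inf' ht id = meetWith x (u.erase (u.max' hune)) (x (u.max' hune)) := by
    refine eq_of_forall_le_iff fun w => ?_
    simp only [Finset.le_inf'_iff, Finset.forall_mem_image, le_meetWith, id]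
    conv_lhs => rw [← Finset.insert_erase hmax]
    rw [Finset.forall_mem_insert]
  rw [heq]
  exact (hV _ i (hu hmax) _ (fun j hj => Finset.lt_max'_of_mem_erase_max' u hune hj)
    (hy i _ fun j hj => hu (Finset.mem_of_mem_erase hj))).1

end Selection

/-! ### Closedness: ω-Lawson and functionally Hausdorff cases -/

section Closure

theorem IsFunctionallyHausdorff.t2Space {Y : Type*} [TopologicalSpace Y]
    (hF : IsFunctionallyHausdorff Y) : T2Space Y :=
  ⟨fun x y hxy => by
    obtain ⟨f, hf, hne⟩ := hF x y hxy
    exact separated_by_continuous hf hne⟩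

variable {Y : Type*} [SemilatticeInf Y] [TopologicalSpace Y]

theorem ChainComplete.exists_mem_of_infClosure_subset (hY : IsSemitopological Y) {S : Set Y}
    (hS : ChainComplete S) (hSinf : InfClosed S) {I : Type*} [LinearOrder I] [Nonempty I]
    [NoMaxOrder I] {V : I → Set Y} {x : I → Y} (hxS : ∀ i, x i ∈ S)
    (hxV : ∀ i, infClosure (x '' Ioi i) ⊆ V i) : ∃ s ∈ S, ∀ i, s ∈ closure (V i) := by
  obtain ⟨s, hs, hsV⟩ := hS.exists_mem_forall_of_antitone
    (A := fun i => closure (infClosure (x '' Ioi i)))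
    (fun i j hij => closure_mono (infClosure.monotone (image_mono (Ioi_subset_Ioi hij))))
    (fun _ => isClosed_closure)
    (fun _ => infClosed_inter hSinf (hY.infClosed_closure infClosed_infClosure))
    (fun i => by
      obtain ⟨j, hj⟩ := exists_gt i
      exact ⟨x j, hxS j, subset_closure (subset_infClosure ⟨j, hj, rfl⟩)⟩)
  exact ⟨s, hs, fun i => closure_mono (hxV i) (hsV i)⟩

/-- Each stage imposes finitely many conditions, each holding near `y` by separate continuity; hence
a point of `B n` meets them all. -/
theorem IsSemitopological.exists_seq_selection (hY : IsSemitopological Y) {y : Y}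
    {l : Filter Y} [l.NeBot] (hl : l ≤ 𝓝 y) {B U : ℕ → Set Y} (hB : ∀ n, B n ∈ l)
    (hU : ∀ n, U n ∈ 𝓝 y) :
    ∃ x : ℕ → Y, (∀ n, x n ∈ B n) ∧ ∀ n, infClosure (x '' Ioi n) ⊆ U n := by
  have key := exists_selection (V := fun n => interior (U n)) (S := B) (y := y)
    (fun n => mem_interior_iff_mem_nhds.2 (hU n)) ?_
  · obtain ⟨x, hxB, hxU⟩ := key
    exact ⟨x, hxB, fun n => (hxU n).trans interior_subset⟩
  intro a x
  have hev : ∀ᶠ z in 𝓝 y, ∀ i ∈ Finset.range a, ∀ t ∈ (Finset.range a).powerset,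
      meetWith x t y ∈ interior (U i) →
        meetWith x t z ∈ interior (U i) ∧ meetWith x t (z ⊓ y) ∈ interior (U i) := by
    rw [Filter.eventually_all_finset]
    intro i _
    rw [Filter.eventually_all_finset]
    intro t _
    by_cases hyt : meetWith x t y ∈ interior (U i)
    · have hc := hY.continuous_meetWith x t
      have h1 := hc.continuousAt.eventually_mem (x := y) (isOpen_interior.mem_nhds hyt)
      have h2 := (hc.comp (hY.2 y)).continuousAt.eventually_mem (x := y)
        (s := interior (U i)) (isOpen_interior.mem_nhds (by simpa using hyt))
      filter_upwards [h1, h2] with z hz1 hz2 _ using ⟨hz1, hz2⟩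
    · simp [hyt]
  obtain ⟨s, hs1, hs2⟩ := ((Filter.Eventually.filter_mono hl hev).and (hB a)).exists
  exact ⟨s, hs2, fun i hi t ht => hs1 i (Finset.mem_range.2 hi) t
    (Finset.mem_powerset.2 fun j hj => Finset.mem_range.2 (ht j hj))⟩

theorem ChainComplete.exists_mem_of_countable_nhds (hY : IsSemitopological Y) {S : Set Y}
    (hS : ChainComplete S) (hSinf : InfClosed S) {y : Y} (hy : y ∈ closure S)
    {𝒰 : Set (Set Y)} (hcount : 𝒰.Countable) (h𝒰 : ∀ U ∈ 𝒰, U ∈ 𝓝 y ∧ IsClosed U) :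
    ∃ s ∈ S, ∀ U ∈ 𝒰, s ∈ U := by
  obtain ⟨U, hU⟩ := (hcount.insert univ).exists_eq_range (insert_nonempty univ 𝒰)
  have hU' : ∀ n, U n ∈ 𝓝 y ∧ IsClosed (U n) := fun n => by
    rcases (hU ▸ mem_range_self n : U n ∈ insert univ 𝒰) with h | h
    · simp [h]
    · exact h𝒰 _ h
  have : (𝓝[S] y).NeBot := mem_closure_iff_nhdsWithin_neBot.1 hy
  obtain ⟨x, hxS, hxU⟩ := hY.exists_seq_selection (l := 𝓝[S] y) nhdsWithin_le_nhds
    (fun _ => self_mem_nhdsWithin) fun n => (hU' n).1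
  obtain ⟨s, hs, hsU⟩ := hS.exists_mem_of_infClosure_subset hY hSinf hxS hxU
  refine ⟨s, hs, fun W hW => ?_⟩
  obtain ⟨n, rfl⟩ := (hU ▸ mem_insert_of_mem univ hW : W ∈ range U)
  exact (hU' n).2.closure_eq ▸ hsU n

/-- Induction on the cardinality of a set: an uncountable set is indexed by a well-order without
greatest element whose cardinality exceeds that of all its initial segments. -/
theorem set_card_induction {α : Type*} {P : Set α → Prop} (hcount : ∀ F : Set α, F.Countable → P F)
    (hstep : ∀ (I : Type _) [LinearOrder I] [WellFoundedLT I] [Nonempty I] [NoMaxOrder I]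
      (e : I → α), (∀ i : I, Cardinal.mk (Iio i) < Cardinal.mk I) →
      Cardinal.aleph0 < Cardinal.mk I →
      (∀ T : Set α, Cardinal.mk T < Cardinal.mk I → P T) → P (range e)) (F : Set α) : P F := by
  induction hF : Cardinal.mk F using Cardinal.lt_wf.induction generalizing F with
  | h κ ih =>
    subst hF
    by_cases hc : F.Countable
    · exact hcount F hc
    have hlt : Cardinal.aleph0 < Cardinal.mk F := by
      rw [← not_le, Cardinal.le_aleph0_iff_set_countable]; exact hc
    have hmk := Cardinal.mk_ord_toType (Cardinal.mk F)
    obtain ⟨e⟩ := Cardinal.eq.1 hmk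
    have := Cardinal.noMaxOrder hlt.le
    have : Nonempty (Cardinal.mk F).ord.ToType := by
      rw [← Cardinal.mk_ne_zero_iff, hmk]
      exact (Cardinal.aleph0_pos.trans hlt).ne'
    have h := hstep (Cardinal.mk F).ord.ToType (fun i => (e i : α))
      (fun i => Cardinal.mk_Iio_lt i (by rw [hmk, Ordinal.type_toType])) (by rwa [hmk])
      (fun T hT => ih _ (hmk ▸ hT) T rfl)
    have hr : range (fun i => (e i : α)) = F := by
      ext z
      exact ⟨by rintro ⟨i, rfl⟩; exact (e i).2, fun hz => ⟨e.symm ⟨z, hz⟩, by simp⟩⟩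
    rwa [hr] at h

theorem ChainComplete.isClosed_of_isOmegaLawson (hY : IsSemitopological Y) {S : Set Y}
    (hS : ChainComplete S) (hSinf : InfClosed S) (hL : IsOmegaLawson Y) : IsClosed S := by
  obtain ⟨hT2, hL⟩ := hL
  -- An infimum of cardinals is attained only over a nonempty set, so an admissible cardinal is
  -- exhibited.
  have hbound : LawsonBound Y (lawsonNumber Y) := by
    refine csInf_mem (s := {κ | LawsonBound Y κ})
      ⟨Cardinal.mk (Set Y), fun x y hxy => ⟨{U | U ∈ 𝓝 x ∧ IsClosed U}, fun U hU => hU,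
        Cardinal.mk_set_le _, ?_⟩⟩
    have heq : ⋂₀ {U | U ∈ 𝓝 x ∧ IsClosed U} = {x} := by
      refine Subset.antisymm (fun z hz => ?_) (by
        rintro _ rfl U hU; exact mem_of_mem_nhds hU.1)
      by_contra hne
      obtain ⟨u, v, hu, hv, hxu, hzv, huv⟩ := t2_separation (Ne.symm hne)
      exact hz vᶜ ⟨Filter.mem_of_superset (hu.mem_nhds hxu) huv.subset_compl_right,
        hv.isClosed_compl⟩ hzv
    rw [heq]
    exact ⟨infClosed_singleton, fun h => hxy h.symm⟩
  refine isClosed_of_closure_subset fun y hy => ?_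
  choose! 𝒰 h𝒰 hcard hinf hnot using fun w (hw : y ≠ w) => hbound y w hw
  have hfam : ∀ W : Set Y, y ∉ W → ∃ s ∈ S, ∀ w ∈ W, s ∈ ⋂₀ 𝒰 w := by
    refine set_card_induction (fun W hW hyW => ?_) (fun I _ _ _ _ e hI _ ih hyW => ?_)
    · have hne : ∀ w ∈ W, y ≠ w := fun w hw h => hyW (h ▸ hw)
      obtain ⟨s, hs, hsU⟩ := hS.exists_mem_of_countable_nhds hY hSinf hy (𝒰 := ⋃ w ∈ W, 𝒰 w)
        (hW.biUnion fun w hw => Cardinal.le_aleph0_iff_set_countable.1 ((hcard w (hne w hw)).trans hL))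
        (fun U hU => by
          obtain ⟨w, hw, hUw⟩ := mem_iUnion₂.1 hU
          exact h𝒰 w (hne w hw) U hUw)
      exact ⟨s, hs, fun w hw U hU => hsU U (mem_biUnion hw hU)⟩
    -- The intersections over initial segments are already closed subsemilattices, so no selection
    -- is needed here.
    · have hne : ∀ i, y ≠ e i := fun i h => hyW ⟨i, h.symm⟩
      obtain ⟨s, hs, hsA⟩ := hS.exists_mem_forall_of_antitone
        (A := fun a : I => ⋂ i ∈ Iio a, ⋂₀ 𝒰 (e i))
        (fun a b hab => biInter_mono (Iio_subset_Iio hab) fun _ _ => Subset.rfl)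
        (fun a => isClosed_biInter fun i _ => isClosed_sInter fun U hU => (h𝒰 _ (hne i) U hU).2)
        (fun a => infClosed_inter hSinf fun p hp q hq => mem_iInter₂.2 fun i hi =>
          hinf _ (hne i) (mem_iInter₂.1 hp i hi) (mem_iInter₂.1 hq i hi))
        (fun a => by
          obtain ⟨s, hs, h⟩ := ih (e '' Iio a) (Cardinal.mk_image_le.trans_lt (hI a))
            (by rintro ⟨i, -, h⟩; exact hne i h.symm)
          exact ⟨s, hs, mem_iInter₂.2 fun i hi => h _ ⟨i, hi, rfl⟩⟩)
      refine ⟨s, hs, ?_⟩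
      rintro _ ⟨i, rfl⟩
      obtain ⟨a, ha⟩ := exists_gt i
      exact mem_iInter₂.1 (hsA a) i ha
  obtain ⟨s, hs, h⟩ := hfam {y}ᶜ (by simp)
  rcases eq_or_ne s y with rfl | hsy
  · exact hs
  · exact absurd (h s hsy) (hnot s hsy.symm)

/-- Zero sets need not be subsemilattices, so the uncountable step reruns the selection, choosing
each point by the induction hypothesis. -/
theorem ChainComplete.exists_mem_zeros (hY : IsSemitopological Y) {S : Set Y}
    (hS : ChainComplete S) (hSinf : InfClosed S) {y : Y} (hy : y ∈ closure S) :
    ∀ F : Set (Y → ℝ), (∀ f ∈ F, Continuous f ∧ f y = 0) → ∃ s ∈ S, ∀ f ∈ F, f s = 0 := by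
  refine set_card_induction (fun F hF hFy => ?_) (fun I _ _ _ _ e hI hI0 ih he => ?_)
  · obtain ⟨s, hs, hsU⟩ := hS.exists_mem_of_countable_nhds hY hSinf hy
      (𝒰 := ⋃ f ∈ F, range fun n : ℕ => {z | |f z| ≤ 1 / ((n : ℝ) + 1)})
      (hF.biUnion fun f _ => countable_range _) (fun U hU => by
        obtain ⟨f, hf, n, rfl⟩ := mem_iUnion₂.1 hU
        obtain ⟨hc, hz⟩ := hFy f hf
        refine ⟨?_, isClosed_le hc.abs continuous_const⟩
        filter_upwards [hc.abs.continuousAt.eventually_lt (x₀ := y) continuousAt_const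
          (by rw [hz, abs_zero]; exact Nat.one_div_pos_of_nat (n := n))] with z hz using hz.le)
    refine ⟨s, hs, fun f hf => ?_⟩
    by_contra hne
    obtain ⟨n, hn⟩ := exists_nat_one_div_lt (abs_pos.2 hne)
    exact hn.not_ge (hsU _ (mem_biUnion hf ⟨n, rfl⟩))
  · have he' : ∀ i, Continuous (e i) ∧ e i y = 0 := fun i => he _ ⟨i, rfl⟩
    obtain ⟨x, hxS, hxV⟩ := exists_selection (V := fun i => {z | e i z = 0}) (S := fun _ => S)
      (fun i => (he' i).2) (fun a x => by
        -- These functions encode all conditions at stage `a`; there are fewer than `I` has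
        -- elements.
        let g : Iio a × Finset (Iio a) × Bool → Y → ℝ := fun p z =>
          e p.1 (meetWith x (p.2.1.map (Function.Embedding.subtype _)) (bif p.2.2 then z else z ⊓ y))
        have hcard : Cardinal.mk (Iio a × Finset (Iio a) × Bool) < Cardinal.mk I := by
          rcases finite_or_infinite (Iio a) with h | h
          · exact (Cardinal.mk_lt_aleph0 (α := Iio a × Finset (Iio a) × Bool)).trans hI0
          · simp only [Cardinal.mk_prod, Cardinal.lift_id, Cardinal.lift_uzero,
              Cardinal.mk_finset_of_infinite]
            exact Cardinal.mul_lt_of_lt hI0.le (hI a) (Cardinal.mul_lt_of_lt hI0.le (hI a)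
              ((Cardinal.lift_lt_aleph0.2 (Cardinal.mk_lt_aleph0 (α := Bool))).trans hI0))
        obtain ⟨s, hs, h⟩ := ih {f | f ∈ range g ∧ f y = 0}
          ((Cardinal.mk_le_mk_of_subset fun f hf => hf.1).trans_lt
            (Cardinal.mk_range_le.trans_lt hcard)) (by
            rintro _ ⟨⟨⟨i, t, b⟩, rfl⟩, hz⟩
            refine ⟨(he' i).1.comp ((hY.continuous_meetWith _ _).comp ?_), hz⟩
            cases b
            · exact hY.2 y
            · exact continuous_id)
        refine ⟨s, hs, fun i hi t ht hty => ?_⟩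
        have hmap : (t.subtype (· ∈ Iio a)).map (Function.Embedding.subtype _) = t := by
          rw [Finset.subtype_map, Finset.filter_true_of_mem (p := (· ∈ Iio a)) ht]
        have hg : ∀ b z, g (⟨i, hi⟩, t.subtype (· ∈ Iio a), b) z =
            e i (meetWith x t (bif b then z else z ⊓ y)) := fun b z => by
          simp only [g, hmap]
        have hgs : ∀ b, g (⟨i, hi⟩, t.subtype (· ∈ Iio a), b) s = 0 := fun b =>
          h _ ⟨⟨_, rfl⟩, by rw [hg]; cases b <;> simpa using hty⟩
        exact ⟨(hg true s).symm.trans (hgs true), (hg false s).symm.trans (hgs false)⟩)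
    obtain ⟨s, hs, hsV⟩ := hS.exists_mem_of_infClosure_subset hY hSinf hxS hxV
    refine ⟨s, hs, ?_⟩
    rintro _ ⟨i, rfl⟩
    have := hsV i
    rwa [(isClosed_eq (he' i).1 continuous_const).closure_eq] at this

theorem ChainComplete.isClosed_of_isFunctionallyHausdorff (hY : IsSemitopological Y) {S : Set Y}
    (hS : ChainComplete S) (hSinf : InfClosed S) (hF : IsFunctionallyHausdorff Y) :
    IsClosed S := by
  refine isClosed_of_closure_subset fun y hy => ?_
  obtain ⟨s, hs, h⟩ := hS.exists_mem_zeros hY hSinf hy {f | Continuous f ∧ f y = 0} fun f hf => hf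
  rcases eq_or_ne s y with rfl | hsy
  · exact hs
  · obtain ⟨f, hf, hne⟩ := hF s y hsy
    exact absurd (sub_eq_zero.1 (h (fun z => f z - f y) ⟨hf.sub continuous_const, sub_self _⟩)) hne

end Closure

/-! ### Closedness: sequential case -/

section Sequential

variable {Y : Type*} [SemilatticeInf Y]

/-- The infima of the members of the filter `l` that are contained in `S`. -/
def filterInfs (S : Set Y) (l : Filter Y) : Set Y := {z | ∃ A ∈ l, A ⊆ S ∧ IsGLB A z}

theorem filterInfs_mono {S : Set Y} {l l' : Filter Y} (h : l' ≤ l) :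
    filterInfs S l ⊆ filterInfs S l' :=
  fun _ ⟨A, hA, hAS, hz⟩ => ⟨A, h hA, hAS, hz⟩

variable [TopologicalSpace Y]

/-- The infima of basis sets increase and are cofinal among all these infima, so their supremum is
the limit inferior of `l`. -/
theorem ChainComplete.exists_isLUB_filterInfs [T2Space Y] (hY : IsSemitopological Y) {S : Set Y}
    (hS : ChainComplete S) (hSinf : InfClosed S) {l : Filter Y} [l.NeBot] {B : ℕ → Set Y}
    (hB : l.HasAntitoneBasis B) (hBS : ∀ n, B n ⊆ S) {K : Set Y} (hK : IsClosed K)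
    (hBK : ∀ n, infClosure (B n) ⊆ K) : ∃ b ∈ S ∩ K, IsLUB (filterInfs S l) b := by
  choose z hzS hz hzcl using fun n =>
    hS.exists_isGLB hY hSinf (hBS n) (l.nonempty_of_mem (hB.mem n))
  have hmono : Monotone z := fun m n hmn => (hz n).2 fun a ha => (hz m).1 (hB.antitone hmn ha)
  obtain ⟨b, hbS, hb, hbcl⟩ := hS.exists_isLUB_range hmono hzS
  refine ⟨b, ⟨hbS, closure_minimal ?_ hK (hbcl 0)⟩, ?_, fun u hu => hb.2 ?_⟩
  · rintro _ ⟨n, -, rfl⟩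
    exact closure_minimal (hBK n) hK (hzcl n)
  · rintro w ⟨A, hA, -, hw⟩
    obtain ⟨n, hn⟩ := hB.mem_iff.1 hA
    exact ((hz n).2 fun a ha => hw.1 (hn ha)).trans (hb.1 ⟨n, rfl⟩)
  · rintro _ ⟨n, rfl⟩
    exact hu ⟨B n, hB.mem n, hBS n, hz n⟩

/-- A sequence in the union involves only countably many countable sets, whose union is again
countable. -/
theorem isClosed_biUnion_closure_countable {Y : Type*} [TopologicalSpace Y] [SequentialSpace Y]
    (D : Set Y) :
    IsClosed (⋃ E ∈ {E | E ⊆ D ∧ E.Countable}, closure E) := by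
  refine IsSeqClosed.isClosed fun u p hu hp => ?_
  simp only [mem_iUnion₂] at hu
  choose E hE huE using hu
  refine mem_biUnion (x := ⋃ n, E n)
    ⟨iUnion_subset fun n => (hE n).1, countable_iUnion fun n => (hE n).2⟩ ?_
  exact isClosed_closure.mem_of_tendsto hp (Filter.Eventually.of_forall fun n =>
    closure_mono (subset_iUnion E n) (huE n))

/-- In a sequential space the chains of a chain complete set have countable cofinality. -/
theorem ChainComplete.exists_countable_cofinal [T2Space Y] [SequentialSpace Y]
    (hY : IsSemitopological Y) {S : Set Y} (hS : ChainComplete S) {D : Set Y} (hD : D ⊆ S)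
    (hne : D.Nonempty) (hchain : IsChain (· ≤ ·) D) :
    ∃ E ⊆ D, E.Countable ∧ ∀ d ∈ D, ∃ e ∈ E, d ≤ e := by
  obtain ⟨z, -, hz, hzcl⟩ := (hS D hD hne hchain).2
  by_cases hzD : z ∈ D
  · exact ⟨{z}, singleton_subset_iff.2 hzD, countable_singleton z, fun d hd => ⟨z, rfl, hz.1 hd⟩⟩
  have hsub : D ⊆ ⋃ E ∈ {E | E ⊆ D ∧ E.Countable}, closure E := fun d hd =>
    mem_biUnion (x := {d}) ⟨singleton_subset_iff.2 hd, countable_singleton d⟩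
      (subset_closure rfl)
  obtain ⟨E, ⟨hED, hE⟩, hzE⟩ := mem_iUnion₂.1
    (closure_minimal hsub (isClosed_biUnion_closure_countable D) hzcl)
  refine ⟨E, hED, hE, fun d hd => ?_⟩
  by_contra! hno
  have hEd : E ⊆ Iic d := fun e he => (hchain.total hd (hED he)).resolve_left (hno e he)
  have hzd : z ≤ d := closure_minimal hEd (hY.isClosed_Iic d) hzE
  exact hzD (hzd.antisymm (hz.1 hd) ▸ hd)

theorem ChainComplete.isClosed_of_sequentialSpace [T2Space Y] [SequentialSpace Y]
    (hY : IsSemitopological Y) {S : Set Y} (hS : ChainComplete S) (hSinf : InfClosed S) :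
    IsClosed S := by
  refine IsSeqClosed.isClosed fun u y hu huy => ?_
  let P := {l : Filter Y // l.NeBot ∧ l.IsCountablyGenerated ∧ S ∈ l ∧ l ≤ 𝓝 y}
  have hbasis : ∀ l : P, ∃ B : ℕ → Set Y, l.1.HasAntitoneBasis B ∧ ∀ n, B n ⊆ S := by
    rintro ⟨l, hl, hc, hSl, hly⟩
    obtain ⟨B, hBS, hB⟩ := (l.basis_sets.restrict_subset hSl).exists_antitone_subbasis
    exact ⟨B, hB, fun n => (hBS n).2⟩
  have hlim : ∀ l : P, ∃ b ∈ S, IsLUB (filterInfs S l.1) b := by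
    intro l
    obtain ⟨B, hB, hBS⟩ := hbasis l
    have := l.2.1
    obtain ⟨b, hb, h⟩ := hS.exists_isLUB_filterInfs hY hSinf hB hBS isClosed_univ
      fun _ => subset_univ _
    exact ⟨b, hb.1, h⟩
  choose L hLS hL using hlim
  have hLmono : ∀ l l' : P, l'.1 ≤ l.1 → L l ≤ L l' := fun l l' h =>
    (hL l).mono (hL l') (filterInfs_mono h)
  -- Requiring `L` to grow strictly lets countable cofinality of the chain of values of `L` give a
  -- countable cofinal family of filters, whose infimum stays countably generated.
  let r : P → P → Prop := fun l l' => l = l' ∨ (l'.1 ≤ l.1 ∧ L l < L l')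
  let l₀ : P := ⟨Filter.map u Filter.atTop, inferInstance, inferInstance,
    Filter.mem_map.2 (Filter.univ_mem' hu), huy⟩
  obtain ⟨m, hm⟩ := exists_maximal_of_chains_bounded (r := r) (by
    intro c hc
    by_cases htop : ∃ e ∈ c, ∀ a ∈ c, r a e
    · obtain ⟨e, -, he⟩ := htop
      exact ⟨e, he⟩
    push Not at htop
    rcases c.eq_empty_or_nonempty with rfl | hne
    · exact ⟨l₀, by simp⟩
    have htotal : ∀ a ∈ c, ∀ b ∈ c, r a b ∨ r b a := fun a ha b hb => by
      by_cases hab : a = b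
      · exact Or.inl (Or.inl hab)
      · exact hc ha hb hab
    have hr : ∀ a b, r a b → b.1 ≤ a.1 ∧ L a ≤ L b := by
      rintro a b (rfl | h)
      · exact ⟨le_rfl, le_rfl⟩
      · exact ⟨h.1, h.2.le⟩
    have hle : ∀ a ∈ c, ∀ b ∈ c, L a ≤ L b → b.1 ≤ a.1 := fun a ha b hb hab => by
      rcases htotal a ha b hb with h | rfl | h
      · exact (hr a b h).1
      · exact le_rfl
      · exact absurd hab h.2.not_ge
    obtain ⟨E, hEc, hE, hcof⟩ := hS.exists_countable_cofinal hY (D := L '' c)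
      (by rintro _ ⟨a, -, rfl⟩; exact hLS a) (hne.image L) (by
        rintro _ ⟨a, ha, rfl⟩ _ ⟨b, hb, rfl⟩ -
        exact (htotal a ha b hb).imp (fun h => (hr a b h).2) fun h => (hr b a h).2)
    choose g hgc hg using fun e : E => hEc e.2
    have hcof' : ∀ a ∈ c, ∃ e : E, L a ≤ L (g e) := fun a ha => by
      obtain ⟨e, he, hae⟩ := hcof _ ⟨a, ha, rfl⟩
      exact ⟨⟨e, he⟩, hae.trans_eq (hg ⟨e, he⟩).symm⟩
    obtain ⟨a₀, ha₀⟩ := hne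
    obtain ⟨e₀, -⟩ := hcof' a₀ ha₀
    have : Nonempty E := ⟨e₀⟩
    have : Countable E := hE.to_subtype
    have : ∀ e : E, (g e).1.IsCountablyGenerated := fun e => (g e).2.2.1
    let q : P := ⟨⨅ e : E, (g e).1, Filter.iInf_neBot_of_directed' (fun d e => by
        rcases htotal _ (hgc d) _ (hgc e) with h | h
        · exact ⟨e, (hr _ _ h).1, le_rfl⟩
        · exact ⟨d, le_rfl, (hr _ _ h).1⟩) fun e => (g e).2.1,
      inferInstance, iInf_le (fun e : E => (g e).1) e₀ (g e₀).2.2.2.1,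
      (iInf_le (fun e : E => (g e).1) e₀).trans (g e₀).2.2.2.2⟩
    have hq : ∀ a ∈ c, q.1 ≤ a.1 := fun a ha => by
      obtain ⟨e, he⟩ := hcof' a ha
      exact (iInf_le (fun e : E => (g e).1) e).trans (hle a ha _ (hgc e) he)
    refine ⟨q, fun a ha => Or.inr ⟨hq a ha, ?_⟩⟩
    obtain ⟨b, hb, hba⟩ := htop a ha
    rcases htotal a ha b hb with (rfl | h) | h
    · exact absurd (Or.inl rfl) hba
    · exact h.2.trans_le (hLmono _ _ (hq b hb))
    · exact absurd h hba) (by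
    rintro a b d (rfl | hab) (rfl | hbd)
    · exact Or.inl rfl
    · exact Or.inr hbd
    · exact Or.inr hab
    · exact Or.inr ⟨hbd.1.trans hab.1, hab.2.trans hbd.2⟩)
  have hstable : ∀ l : P, l.1 ≤ m.1 → L l = L m := fun l hl => by
    by_contra hne
    have hlt : L m < L l := (hLmono _ _ hl).lt_of_ne (Ne.symm hne)
    rcases hm l (Or.inr ⟨hl, hlt⟩) with rfl | h
    · exact hne rfl
    · exact h.2.asymm hlt
  have hmem : ∀ U ∈ 𝓝 y, IsClosed U → L m ∈ U := by
    intro U hU hUcl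
    obtain ⟨B, hB, hBS⟩ := hbasis m
    have := m.2.1
    obtain ⟨x, hxB, hxU⟩ := hY.exists_seq_selection m.2.2.2.2 hB.mem fun _ => hU
    -- The shift is needed because `hxU 0` controls only indices above `0`.
    have hx : Filter.Tendsto (fun n => x (n + 1)) Filter.atTop m.1 :=
      (hB.tendsto hxB).comp (Filter.tendsto_add_atTop_nat 1)
    have hxS : ∀ n, x n ∈ S := fun n => hBS n (hxB n)
    let q : P := ⟨Filter.map (fun n => x (n + 1)) Filter.atTop, inferInstance, inferInstance,
      Filter.mem_map.2 (Filter.univ_mem' fun n => hxS _), hx.trans m.2.2.2.2⟩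
    have hqB : q.1.HasAntitoneBasis fun n => (fun n => x (n + 1)) '' Ici n :=
      Filter.HasAntitoneBasis.map ⟨Filter.atTop_basis, fun _ _ h => Ici_subset_Ici.2 h⟩ _
    have := q.2.1
    obtain ⟨b, ⟨-, hbU⟩, hb⟩ := hS.exists_isLUB_filterInfs hY hSinf hqB
      (by rintro n _ ⟨k, -, rfl⟩; exact hxS _) hUcl fun n => by
        refine (infClosure.monotone ?_).trans (hxU 0)
        rintro _ ⟨k, -, rfl⟩
        exact ⟨k + 1, Nat.succ_pos k, rfl⟩
    -- Passing to the finer filter `q` leaves the maximal value `L m` unchanged, while the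
    -- controlled meets put it in `U`.
    rw [← hstable q hx, (hL q).unique hb]
    exact hbU
  suffices L m = y from this ▸ hLS m
  by_contra hne
  obtain ⟨v, w, hv, hw, hmv, hyw, hvw⟩ := t2_separation hne
  exact hmem vᶜ (Filter.mem_of_superset (hw.mem_nhds hyw) hvw.subset_compl_left) hv.isClosed_compl
    hmv

end Sequential

end TopSemilattice

theorem corollary2p7 {X Y : Type*} [SemilatticeInf X] [TopologicalSpace X]
    [SemilatticeInf Y] [TopologicalSpace Y]
    (hX : TopSemilattice.IsComplete X)
    (hY : TopSemilattice.IsSemitopological Y)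
    (hsep : TopSemilattice.IsOmegaLawson Y ∨ TopSemilattice.IsFunctionallyHausdorff Y ∨
      (T2Space Y ∧ SequentialSpace Y))
    (Φ : X → Set Y)
    (husc : TopSemilattice.IsUpperSemicontinuous Φ)
    (hΦ : TopSemilattice.IsT1Multimorphism Φ)
    (hord : ∀ x y : X, x ≤ y → Φ x ∩ (upperClosure (Φ y) : Set Y) ⊆ Φ y)
    (hfib : ∀ x : X, TopSemilattice.IsComplete (Φ x)) :
    IsClosed (TopSemilattice.image Φ Set.univ) := by
  have : T2Space Y := by
    rcases hsep with h | h | h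
    exacts [h.1, h.t2Space, h.1]
  have hS := TopSemilattice.chainComplete_image hX hY husc hΦ.1 hfib
  have hSinf := hΦ.1.infClosed_image
  rcases hsep with h | h | ⟨-, _⟩
  · exact hS.isClosed_of_isOmegaLawson hY hSinf h
  · exact hS.isClosed_of_isFunctionallyHausdorff hY hSinf h
  · exact hS.isClosed_of_sequentialSpace hY hSinf
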